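/- Graphs are directed, with finitely many vertices and at most countably many edges, and are considered up to isomorphism. A vertex is \emph{regular} if it emits at least one and only finitely many edges, \emph{singular} otherwise; a \emph{source} receives no edges; paths have length at least one. \textbf{Representation.} Let $E$ be a graph with at most one regular source, and let $1,\dots,n$ be an enumeration of the vertices that are not regular sources. Then $E$ is represented by $(\mathsf D,\mathsf B)$, where $\mathsf B=(b_{ik})$, $b_{ik}=a_{ki}-\delta_{ik}\in\mathbb Z\cup\{\infty\}$ with $a_{ki}$ the number of edges from $k$ to $i$, and $d_i=c_i+1$ with $c_i$ the number of edges from the regular source to $i$ ($c_i=0$ for all $i$ if there is no regular source). \textbf{Augmented canonical form.} For $i\in\{1,\dots,n\}$ let $\gamma(i)$ consist of $i$ and all $k$ for which there are paths from $i$ to $k$ and from $k$ to $i$; let $|\gamma(i)|^\bullet$ be its number of regular vertices, and let $\mathsf B^\bullet_{\gamma(i)}$ be the submatrix of $\mathsf B$ with rows in $\gamma(i)$ and columns the regular vertices in $\gamma(i)$. Put $\operatorname{mr}(\gamma(i))=k+\ell$, where $\operatorname{cok}\mathsf B^\bullet_{\gamma(i)}\cong\mathbb Z/m_1\oplus\cdots\oplus\mathbb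 Z/m_k\oplus\mathbb Z^\ell$ with $m_r\ge 2$ and $m_r\mid m_{r+1}$. The graph $E$ is in augmented canonical form if (I) every regular vertex that is not a source supports a loop; and for all $i,k\in\{1,\dots,n\}$: (II) if there is a path from $i$ to $k$, there is an edge from $i$ to $k$; (III) if there is a path from $i$ to $k$ and $i$ emits infinitely many edges, there are infinitely many edges from $i$ to $k$; (IV) if there are two different paths from $i$ to $i$, neither visiting $i$ along the way, then $i$ supports at least two loops and $|\gamma(i)|^\bullet\ge\max\{3,\operatorname{mr}(\gamma(i))+2\}$. \textbf{Moves.} (O): let $w$ be a vertex that is not a sink, and partition the edges emitted by $w$ into nonempty sets $\mathcal E_1,\dots,\mathcal E_m$, at most one of which is infinite. Replace $w$ by $w^1,\dots,w^m$ and every edge $e$ with range $w$ by $e^1,\dots,e^m$, where $e^r$ has range $w^r$; each edge (or copy of an edge) $e$ emitted by $w$ gets source $w^r$ if $e\in\mathcal E_r$; all other sources and ranges are unchanged. (I$-$): let $w$ be a regular vertex, and partition the edges received by $w$ into possibly empty sets $\mathcal E_1,\dots,\mathcal E_m$. Replace $w$ by $w^1,\dots,w^m$ and every edge $e$ with source $w$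 by $e^1,\dots,e^m$, where $e^r$ has source $w^r$; each edge (or copy of an edge) $e$ received by $w$ gets range $w^r$ if $e\in\mathcal E_r$; all other sources and ranges are unchanged. (I$+$): two graphs are related by (I$+$) if both arise from one graph $G$ by an (I$-$) move at the same regular vertex with the same number $m\geq 1$ of sets. (R$+$): let $w$ be a regular vertex that does not support a loop. Remove $w$ and all edges into or out of $w$; add an edge $[ef]$ from the source of $e$ to the range of $f$ for each edge $e$ into $w$ and each edge $f$ out of $w$; add a new vertex $\tilde w$ and an edge $\tilde f$ from $\tilde w$ to the range of $f$ for each edge $f$ out of $w$. \textbf{Theorem.} Let $E$ be a graph in augmented canonical form represented by $(\mathsf D,\mathsf B)$, and let $j\in\{1,\dots,n\}$ be a regular vertex. Then the pair $(\mathsf D',\mathsf B)$ with $d'_i=d_i+b_{ij}$ for $i=1,\dots,n$ represents a graph, and $E$ can be transformed into the graph represented by $(\mathsf D',\mathsf B)$ by finitely many moves (O), (I$+$), (R$+$) and inverses of such moves. -/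

import Mathlib

universe u

/-- Directed multigraphs with finitely many vertices and at most countably many edges. -/
structure DirGraph : Type (u + 1) where
  Vert : Type u
  Edge : Type u
  src : Edge → Vert
  rng : Edge → Vert
  finite_vert : Finite Vert
  countable_edge : Countable Edge

namespace DirGraph

attribute [instance] DirGraph.finite_vert DirGraph.countable_edge

section Basic

variable (E : DirGraph.{u})

/-- The number of edges from `v` to `w`, an element of `{0, 1, …, ∞}`. -/
noncomputable def edgeCount (v w : E.Vert) : ℕ∞ :=
  ENat.card {e : E.Edge // E.src e = v ∧ E.rng e = w}

/-- A sink emits no edges. -/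
def IsSink (v : E.Vert) : Prop := ∀ e, E.src e ≠ v

/-- A source receives no edges. -/
def IsSource (v : E.Vert) : Prop := ∀ e, E.rng e ≠ v

/-- An infinite emitter emits infinitely many edges. -/
def IsInfiniteEmitter (v : E.Vert) : Prop := {e | E.src e = v}.Infinite

/-- A regular vertex emits finitely many edges, and at least one; the other vertices are the
singular ones. -/
def IsRegular (v : E.Vert) : Prop := {e | E.src e = v}.Finite ∧ {e | E.src e = v}.Nonempty

def IsRegularSource (v : E.Vert) : Prop := E.IsRegular v ∧ E.IsSource v

def SupportsLoop (v : E.Vert) : Prop := ∃ e, E.src e = v ∧ E.rng e = v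

/-- The list of edges `p` is a path from `u` to `v` (the empty list is the trivial path). -/
def IsPath : E.Vert → List E.Edge → E.Vert → Prop
  | u, [], v => u = v
  | u, e :: p, v => E.src e = u ∧ IsPath (E.rng e) p v

/-- There is a path of length at least one from `u` to `v`. -/
def HasPath (u v : E.Vert) : Prop := ∃ p : List E.Edge, p ≠ [] ∧ E.IsPath u p v

/-- `p` is a path of length at least one from `v` to itself that does not visit `v` along the
way. -/
def IsReturnPath (v : E.Vert) (p : List E.Edge) : Prop :=
  p ≠ [] ∧ E.IsPath v p v ∧ ∀ e ∈ p.dropLast, E.rng e ≠ v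

/-- The component `γ(v)`. -/
def component (v : E.Vert) : Set E.Vert := {w | w = v ∨ (E.HasPath v w ∧ E.HasPath w v)}

/-- The set of regular vertices of the component `γ(v)`. -/
def regularComponent (v : E.Vert) : Set E.Vert := {w | w ∈ E.component v ∧ E.IsRegular w}

open scoped Classical in
/-- The diagonal block of `B` belonging to `γ(v)`, with only the columns of the regular vertices
kept: the entry at `(i, k)` is the number of edges from `k` to `i`, minus one if `i = k`.
That number is finite as `k` is regular. -/
noncomputable def regularBlock (v : E.Vert) :
    Matrix (E.component v) (E.regularComponent v) ℤ :=
  fun i k => ((E.edgeCount k.1 i.1).toNat : ℤ) - if i.1 = k.1 then 1 else 0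

/-- The cokernel of `regularBlock`, i.e. the quotient of `ℤ^γ(v)` by the span of its columns. -/
abbrev regularCokernel (v : E.Vert) : Type u :=
  (E.component v → ℤ) ⧸
    Submodule.span ℤ (Set.range fun k : E.regularComponent v => fun i => E.regularBlock v i k)

end Basic

/-- The number `k + l`, where `M ≅ ℤ/d₁ ⊕ ⋯ ⊕ ℤ/d_k ⊕ ℤ^l` with all `d_i ≥ 2` and `d_i ∣ d_{i+1}`,
for a finitely generated abelian group `M`. (By the structure theorem there is exactly
one such number.) -/
noncomputable def numInvariantFactors (M : Type u) [AddCommGroup M] : ℕ :=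
  sInf {m : ℕ | ∃ (k l : ℕ) (d : Fin k → ℕ), m = k + l ∧ (∀ i, 2 ≤ d i) ∧
    (∀ i j, i ≤ j → d i ∣ d j) ∧ Nonempty (M ≃+ ((i : Fin k) → ZMod (d i)) × (Fin l → ℤ))}

/-- The number `mr(γ(v))`. -/
noncomputable def mr (E : DirGraph.{u}) (v : E.Vert) : ℕ :=
  numInvariantFactors (E.regularCokernel v)

/-- Augmented canonical form. The conditions (II)-(IV) are about the vertices that are
not regular sources. -/
structure AugmentedCanonicalForm (E : DirGraph.{u}) : Prop where
  loops : ∀ v, E.IsRegular v → ¬ E.IsSource v → E.SupportsLoop v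
  paths : ∀ v w, ¬ E.IsRegularSource v → ¬ E.IsRegularSource w → E.HasPath v w →
    ∃ e, E.src e = v ∧ E.rng e = w
  infinite_emitters : ∀ v w, ¬ E.IsRegularSource v → ¬ E.IsRegularSource w → E.HasPath v w →
    E.IsInfiniteEmitter v → {e | E.src e = v ∧ E.rng e = w}.Infinite
  two_paths : ∀ v, ¬ E.IsRegularSource v →
    (∃ p q, p ≠ q ∧ E.IsReturnPath v p ∧ E.IsReturnPath v q) →
    2 ≤ E.edgeCount v v ∧ max 3 (E.mr v + 2) ≤ (E.regularComponent v).ncard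

/-- The graph `E` is represented by the pair `(D, B)`, with respect to the enumeration
`x 0, …, x (n - 1)` of the vertices that are not regular sources: there is at most one regular
source, `B i k` is the number of edges from `x k` to `x i`, minus one if `i = k`, and
`D i` is one more than the number of edges from the regular source, if any, to `x i`. -/
structure RepresentedBy (E : DirGraph.{u}) {n : ℕ} (x : Fin n → E.Vert)
    (D : Fin n → WithTop ℤ) (B : Matrix (Fin n) (Fin n) (WithTop ℤ)) : Prop where
  injective : Function.Injective x
  mem_range_iff : ∀ v, v ∈ Set.range x ↔ ¬ E.IsRegularSource v
  subsingleton_regularSource : {v | E.IsRegularSource v}.Subsingleton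
  B_eq : ∀ i k, B i k =
    WithTop.map (fun a : ℕ => (a : ℤ) - if i = k then 1 else 0) (E.edgeCount (x k) (x i))
  D_eq : ∀ i, D i = WithTop.map (fun c : ℕ => (c : ℤ) + 1)
    (ENat.card {e : E.Edge // E.IsRegularSource (E.src e) ∧ E.rng e = x i})

/-- Isomorphism of graphs. -/
def Iso (E F : DirGraph.{u}) : Prop :=
  ∃ (f : E.Vert ≃ F.Vert) (g : E.Edge ≃ F.Edge),
    (∀ e, F.src (g e) = f (E.src e)) ∧ (∀ e, F.rng (g e) = f (E.rng e))

open scoped Classical in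
/-- The out-split graph of `E` at `w`, where the edges that `w` emits are partitioned
by the map `part`. A vertex `v ≠ w` is kept and `w` is replaced by `w¹, …, wⁿ`; an edge `e` with
range other than `w` is kept and one with range `w` is replaced by `e¹, …, eⁿ`. -/
noncomputable def outSplit (E : DirGraph.{u}) (w : E.Vert) {n : ℕ}
    (part : {e : E.Edge // E.src e = w} → Fin n) : DirGraph.{u} :=
  let source : E.Edge → {v : E.Vert // v ≠ w} ⊕ Fin n := fun e =>
    if h : E.src e = w then Sum.inr (part ⟨e, h⟩) else Sum.inl ⟨E.src e, h⟩
  { Vert := {v : E.Vert // v ≠ w} ⊕ Fin n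
    Edge := {e : E.Edge // E.rng e ≠ w} ⊕ ({e : E.Edge // E.rng e = w} × Fin n)
    src := Sum.elim (fun e => source e.1) (fun p => source p.1.1)
    rng := Sum.elim (fun e => Sum.inl ⟨E.rng e.1, e.2⟩) (fun p => Sum.inr p.2)
    finite_vert := inferInstance
    countable_edge := inferInstance }

/-- `F` is (isomorphic to) a graph formed by performing move (O) to `E`. -/
def MoveO (E F : DirGraph.{u}) : Prop :=
  ∃ (w : E.Vert) (n : ℕ) (part : {e : E.Edge // E.src e = w} → Fin n),
    ¬ E.IsSink w ∧ Function.Surjective part ∧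
    {i : Fin n | {e | part e = i}.Infinite}.Subsingleton ∧ Iso F (E.outSplit w part)

open scoped Classical in
/-- The in-split graph of `E` at `w`, where the edges that `w` receives are partitioned
by the map `part`. A vertex `v ≠ w` is kept and `w` is replaced by `w¹, …, wⁿ`; an edge `e` with
source other than `w` is kept and one with source `w` is replaced by `e¹, …, eⁿ`. -/
noncomputable def inSplit (E : DirGraph.{u}) (w : E.Vert) {n : ℕ}
    (part : {e : E.Edge // E.rng e = w} → Fin n) : DirGraph.{u} :=
  let range : E.Edge → {v : E.Vert // v ≠ w} ⊕ Fin n := fun e =>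
    if h : E.rng e = w then Sum.inr (part ⟨e, h⟩) else Sum.inl ⟨E.rng e, h⟩
  { Vert := {v : E.Vert // v ≠ w} ⊕ Fin n
    Edge := {e : E.Edge // E.src e ≠ w} ⊕ ({e : E.Edge // E.src e = w} × Fin n)
    src := Sum.elim (fun e => Sum.inl ⟨E.src e.1, e.2⟩) (fun p => Sum.inr p.2)
    rng := Sum.elim (fun e => range e.1) (fun p => range p.1.1)
    finite_vert := inferInstance
    countable_edge := inferInstance }

/-- `E` and `F` are move (I+) equivalent: both are (isomorphic to) in-split graphs of one graph at
one regular vertex, by partitions with the same number of (possibly empty) sets. -/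
def MoveIPlus (E F : DirGraph.{u}) : Prop :=
  ∃ (G : DirGraph.{u}) (w : G.Vert) (n : ℕ) (part part' : {e : G.Edge // G.rng e = w} → Fin n),
    G.IsRegular w ∧ 1 ≤ n ∧ Iso E (G.inSplit w part) ∧ Iso F (G.inSplit w part')

/-- The graph obtained from `E` by unital reduction at a vertex `w` without loops. The edges are
the edges of `E` that avoid `w`, the edges `[ef]` for `e` into `w` and `f` out of `w`, and
the edges `f~` for `f` out of `w`; the new source `w~` is `Sum.inr PUnit.unit`. -/
def reduction (E : DirGraph.{u}) (w : E.Vert) (hw : ¬ E.SupportsLoop w) : DirGraph.{u} where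
  Vert := {v : E.Vert // v ≠ w} ⊕ PUnit.{u + 1}
  Edge := {e : E.Edge // E.src e ≠ w ∧ E.rng e ≠ w} ⊕
    (({e : E.Edge // E.rng e = w} × {f : E.Edge // E.src f = w}) ⊕ {f : E.Edge // E.src f = w})
  src := Sum.elim (fun e => Sum.inl ⟨E.src e.1, e.2.1⟩)
    (Sum.elim (fun p => Sum.inl ⟨E.src p.1.1, fun h => hw ⟨p.1.1, h, p.1.2⟩⟩)
      (fun _ => Sum.inr PUnit.unit))
  rng := Sum.elim (fun e => Sum.inl ⟨E.rng e.1, e.2.2⟩)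
    (Sum.elim (fun p => Sum.inl ⟨E.rng p.2.1, fun h => hw ⟨p.2.1, p.2.2, h⟩⟩)
      (fun f => Sum.inl ⟨E.rng f.1, fun h => hw ⟨f.1, f.2, h⟩⟩))
  finite_vert := inferInstance
  countable_edge := inferInstance

/-- `F` is (isomorphic to) a graph formed by performing move (R+) to `E`. -/
def MoveRPlus (E F : DirGraph.{u}) : Prop :=
  ∃ (w : E.Vert) (hw : ¬ E.SupportsLoop w), E.IsRegular w ∧ Iso F (E.reduction w hw)

/-- `F` is obtained from `E` by finitely many moves of type (O), (I+) and (R+), i.e. by such moves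
and their inverses, graphs being considered up to isomorphism. -/
def MoveEquiv (E F : DirGraph.{u}) : Prop :=
  Relation.EqvGen (fun G H => Iso G H ∨ MoveO G H ∨ MoveIPlus G H ∨ MoveRPlus G H) E F

end DirGraph

namespace DirGraph

/-! Up to isomorphism a graph is its matrix of edge counts. So a represented graph is `withSource A
c`: the matrix `A` on the vertices that are not regular sources, and the row `c` of the source.
Write e_j for the unit vector at `j`. As `j` supports a loop, row `j` is `A j = b + e_j` with `b ≥
0`, and the claim becomes `withSource A c ~ withSource A (c + b)`.

Two tools suffice. Delaying (`moveEquiv_addVertex_single`): a source with one edge to `j` may be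
exchanged for one emitting row `j`, because both graphs are reductions of the same graph. Splitting
(`moveEquiv_withSource_split_reduce`): a loopless part of the row of a vertex is split off by (O)
and reduced by (R+), and the resulting source is merged into the old one.

`moveEquiv_withSource_add` combines them. If the source has an edge to `j`, delaying turns that e_j
into `b + e_j`. If another vertex `k` has an edge to `j`, splitting off that edge creates a source
edge to `j`, and the same splitting is undone after delaying. Otherwise `j` receives only its own
loops; condition (IV) then leaves just one loop, and splitting `b` off from `j` itself restores `A`
and adds `b` to `c`. -/

/-! ### Graphs as matrices of edge counts -/

/-- `ENat.card` merges all infinite cardinals, which is harmless for countable types. -/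
theorem nonempty_equiv_of_enatCard_eq {α β : Type*} [Countable α] [Countable β]
    (h : ENat.card α = ENat.card β) : Nonempty (α ≃ β) := by
  cases finite_or_infinite α
  · have hβ : Finite β := by
      by_contra hβ
      rw [not_finite_iff_infinite] at hβ
      rw [ENat.card_eq_top.2 hβ, ENat.card_eq_top, ← not_finite_iff_infinite] at h
      exact h inferInstance
    exact ⟨(Finite.equivFin α).trans ((finCongr (by simpa [ENat.card_eq_coe_natCard] using h)).trans
      (Finite.equivFin β).symm)⟩
  · have hβ : Infinite β := by rwa [← ENat.card_eq_top, ← h, ENat.card_eq_top]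
    exact nonempty_equiv_of_countable

/-- A countable type with `a` elements. -/
abbrev Below (a : ℕ∞) : Type := {k : ℕ // (k : ℕ∞) < a}

@[simp]
theorem card_below (a : ℕ∞) : ENat.card (Below a) = a := by
  induction a using ENat.recTopCoe with
  | top =>
    rw [ENat.card_congr (Equiv.subtypeUnivEquiv fun k => ENat.natCast_lt_top k)]
    exact ENat.card_eq_top.2 inferInstance
  | coe m =>
    rw [ENat.card_congr (β := Fin m)
      ⟨fun k => ⟨k.1, Nat.cast_lt.1 k.2⟩, fun k => ⟨k.1, Nat.cast_lt.2 k.2⟩,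
        fun _ => rfl, fun _ => rfl⟩]
    simp

/-- The graph with vertex set `W` and `M u v` edges from `u` to `v`. -/
def ofMatrix (W : Type u) [Finite W] (M : W → W → ℕ∞) : DirGraph.{u} where
  Vert := W
  Edge := Σ p : W × W, Below (M p.1 p.2)
  src e := e.1.1
  rng e := e.1.2
  finite_vert := inferInstance
  countable_edge := inferInstance

@[simp]
theorem edgeCount_ofMatrix {W : Type u} [Finite W] (M : W → W → ℕ∞) (u v : W) :
    (ofMatrix W M).edgeCount u v = M u v := by
  rw [← card_below (M u v)]
  refine ENat.card_congr ⟨fun e => ⟨e.1.2.1, ?_⟩, fun k => ⟨⟨(u, v), k⟩, rfl, rfl⟩, ?_, ?_⟩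
  · obtain ⟨⟨⟨a, b⟩, k⟩, rfl, rfl⟩ := e
    exact k.2
  · rintro ⟨⟨⟨a, b⟩, k⟩, rfl, rfl⟩
    rfl
  · intro k
    rfl

/-- Bijections between the countable fibres of (source, range) glue to a bijection of edges. -/
theorem iso_of_edgeCount {E F : DirGraph.{u}} (f : E.Vert ≃ F.Vert)
    (h : ∀ u v, E.edgeCount u v = F.edgeCount (f u) (f v)) : Iso E F := by
  have key : ∀ p : E.Vert × E.Vert, Nonempty ({e : E.Edge // (E.src e, E.rng e) = p} ≃
      {e : F.Edge // (F.src e, F.rng e) = (f.prodCongr f) p}) := by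
    rintro ⟨u, v⟩
    apply nonempty_equiv_of_enatCard_eq
    simpa [edgeCount, Prod.ext_iff] using h u v
  let g := fun p => (key p).some
  let G : E.Edge ≃ F.Edge := (Equiv.sigmaFiberEquiv fun e => (E.src e, E.rng e)).symm.trans
    (((f.prodCongr f).sigmaCongr g).trans (Equiv.sigmaFiberEquiv fun e => (F.src e, F.rng e)))
  have hG : ∀ e, (F.src (G e), F.rng (G e)) = (f (E.src e), f (E.rng e)) := fun e =>
    (g (E.src e, E.rng e) ⟨e, rfl⟩).2
  exact ⟨f, G, fun e => congrArg Prod.fst (hG e), fun e => congrArg Prod.snd (hG e)⟩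

theorem iso_ofMatrix {E : DirGraph.{u}} {W : Type u} [Finite W] {M : W → W → ℕ∞}
    (f : W ≃ E.Vert) (h : ∀ u v, M u v = E.edgeCount (f u) (f v)) : Iso (ofMatrix W M) E :=
  iso_of_edgeCount f fun u v => (edgeCount_ofMatrix M u v).trans (h u v)

theorem edgeCount_eq_zero_iff (E : DirGraph.{u}) (u v : E.Vert) :
    E.edgeCount u v = 0 ↔ ∀ e, E.src e = u → E.rng e ≠ v := by
  rw [edgeCount, ENat.card_eq_zero_iff_empty, isEmpty_subtype]
  simp

theorem edgeCount_eq_top_iff (E : DirGraph.{u}) (u v : E.Vert) :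
    E.edgeCount u v = ⊤ ↔ {e | E.src e = u ∧ E.rng e = v}.Infinite := by
  rw [edgeCount, ENat.card_eq_top, ← Set.infinite_coe_iff]
  rfl

/-- There are finitely many ranges, so an infinite emitter sends infinitely many edges to one of
them. -/
theorem finite_emitted_iff (E : DirGraph.{u}) (v : E.Vert) :
    {e | E.src e = v}.Finite ↔ ∀ w, E.edgeCount v w ≠ ⊤ := by
  have : {e | E.src e = v} = ⋃ w, {e | E.src e = v ∧ E.rng e = w} := by
    ext e
    simp
  simp only [ne_eq, edgeCount_eq_top_iff, Set.not_infinite]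
  exact ⟨fun h w => h.subset fun e he => he.1, fun h => this ▸ Set.finite_iUnion h⟩

theorem isSink_iff (E : DirGraph.{u}) (v : E.Vert) :
    E.IsSink v ↔ ∀ w, E.edgeCount v w = 0 := by
  simp only [edgeCount_eq_zero_iff]
  exact ⟨fun h _ e he => absurd he (h e), fun h e he => h _ e he rfl⟩

theorem isSource_iff (E : DirGraph.{u}) (v : E.Vert) :
    E.IsSource v ↔ ∀ w, E.edgeCount w v = 0 := by
  simp only [edgeCount_eq_zero_iff]
  exact ⟨fun h _ e _ => h e, fun h e => h _ e rfl⟩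

theorem isRegular_iff (E : DirGraph.{u}) (v : E.Vert) :
    E.IsRegular v ↔ (∀ w, E.edgeCount v w ≠ ⊤) ∧ ∃ w, E.edgeCount v w ≠ 0 := by
  rw [IsRegular, finite_emitted_iff, ← not_forall_not (p := fun w => E.edgeCount v w ≠ 0)]
  simp only [not_not, ← isSink_iff]
  simp [IsSink, Set.Nonempty]

theorem supportsLoop_iff (E : DirGraph.{u}) (v : E.Vert) :
    E.SupportsLoop v ↔ E.edgeCount v v ≠ 0 := by
  simp [edgeCount_eq_zero_iff, SupportsLoop]

/-! ### Edge counts after (R+) -/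

section Reduction

variable (E : DirGraph.{u}) (w : E.Vert) (hw : ¬ E.SupportsLoop w)

theorem edgeCount_reduction_inl_inl (u v : {v : E.Vert // v ≠ w}) :
    (E.reduction w hw).edgeCount (Sum.inl u) (Sum.inl v) =
      E.edgeCount u v + E.edgeCount u w * E.edgeCount w v := by
  unfold edgeCount
  rw [← ENat.card_prod, ← ENat.card_sum]
  symm
  refine ENat.card_congr (Equiv.ofBijective (Sum.elim
    (fun e => ⟨Sum.inl ⟨e.1, fun h => u.2 (e.2.1.symm.trans h), fun h => v.2 (e.2.2.symm.trans h)⟩, ?_, ?_⟩)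
    (fun p => ⟨Sum.inr (Sum.inl (⟨p.1.1, p.1.2.2⟩, ⟨p.2.1, p.2.2.1⟩)), ?_, ?_⟩)) ⟨?_, ?_⟩)
  · exact congrArg Sum.inl (Subtype.ext e.2.1)
  · exact congrArg Sum.inl (Subtype.ext e.2.2)
  · exact congrArg Sum.inl (Subtype.ext p.1.2.1)
  · exact congrArg Sum.inl (Subtype.ext p.2.2.2)
  · rintro (⟨a, ha⟩ | ⟨⟨a, ha⟩, b, hb⟩) (⟨a', ha'⟩ | ⟨⟨a', ha'⟩, b', hb'⟩) h <;>
      cases h <;> rfl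
  · rintro ⟨a | a | a, h1, h2⟩
    · exact ⟨Sum.inl ⟨a.1, congrArg Subtype.val (Sum.inl_injective h1),
        congrArg Subtype.val (Sum.inl_injective h2)⟩, rfl⟩
    · exact ⟨Sum.inr (⟨a.1.1, congrArg Subtype.val (Sum.inl_injective h1), a.1.2⟩,
        ⟨a.2.1, a.2.2, congrArg Subtype.val (Sum.inl_injective h2)⟩), rfl⟩
    · exact absurd h1 Sum.inr_ne_inl

theorem edgeCount_reduction_inr_inl (v : {v : E.Vert // v ≠ w}) :
    (E.reduction w hw).edgeCount (Sum.inr PUnit.unit) (Sum.inl v) = E.edgeCount w v := by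
  unfold edgeCount
  symm
  refine ENat.card_congr (Equiv.ofBijective
    (fun e => ⟨Sum.inr (Sum.inr ⟨e.1, e.2.1⟩), rfl, congrArg Sum.inl (Subtype.ext e.2.2)⟩)
    ⟨?_, ?_⟩)
  · rintro ⟨a, ha⟩ ⟨a', ha'⟩ h
    cases h
    rfl
  · rintro ⟨a | a | a, h1, h2⟩
    · exact absurd h1 Sum.inl_ne_inr
    · exact absurd h1 Sum.inl_ne_inr
    · exact ⟨⟨a.1, a.2, congrArg Subtype.val (Sum.inl_injective h2)⟩, rfl⟩

theorem edgeCount_reduction_inr (u : (E.reduction w hw).Vert) :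
    (E.reduction w hw).edgeCount u (Sum.inr PUnit.unit) = 0 := by
  refine (edgeCount_eq_zero_iff _ _ _).2 ?_
  rintro (e | e | e) - <;> exact Sum.inl_ne_inr

end Reduction

/-! ### Edge counts after (O) -/

section OutSplit

variable (E : DirGraph.{u}) (w : E.Vert) {n : ℕ} (part : {e : E.Edge // E.src e = w} → Fin n)

/-- The number of edges from `w` to `v` in the `r`-th part of a partition of the edges that `w`
emits. -/
noncomputable def partCount (r : Fin n) (v : E.Vert) : ℕ∞ :=
  ENat.card {e : {e : E.Edge // E.src e = w} // part e = r ∧ E.rng e.1 = v}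

open scoped Classical in
theorem edgeCount_outSplit :
    (∀ u v : {v : E.Vert // v ≠ w},
      (E.outSplit w part).edgeCount (Sum.inl u) (Sum.inl v) = E.edgeCount u v) ∧
    (∀ (u : {v : E.Vert // v ≠ w}) (s : Fin n),
      (E.outSplit w part).edgeCount (Sum.inl u) (Sum.inr s) = E.edgeCount u w) ∧
    (∀ (r : Fin n) (v : {v : E.Vert // v ≠ w}),
      (E.outSplit w part).edgeCount (Sum.inr r) (Sum.inl v) = E.partCount w part r v) ∧
    ∀ r s : Fin n,
      (E.outSplit w part).edgeCount (Sum.inr r) (Sum.inr s) = E.partCount w part r w := by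
  have hsrc : ∀ e (u : {v : E.Vert // v ≠ w}), ((if h : E.src e = w then Sum.inr (part ⟨e, h⟩)
      else Sum.inl ⟨E.src e, h⟩ : {v : E.Vert // v ≠ w} ⊕ Fin n) = Sum.inl u) ↔
        E.src e = u := by
    intro e u
    split_ifs with h
    · simp [h, u.2.symm]
    · simp [Subtype.ext_iff]
  have hsrc' : ∀ e (r : Fin n), ((if h : E.src e = w then Sum.inr (part ⟨e, h⟩)
      else Sum.inl ⟨E.src e, h⟩ : {v : E.Vert // v ≠ w} ⊕ Fin n) = Sum.inr r) ↔
        ∃ h : E.src e = w, part ⟨e, h⟩ = r := by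
    intro e u
    split_ifs with h
    · simp [h]
    · simp [h]
  unfold edgeCount partCount
  refine ⟨fun u v => ?_, fun u s => ?_, fun r v => ?_, fun r s => ?_⟩ <;> symm
  · refine ENat.card_congr (Equiv.ofBijective
      (fun e => ⟨Sum.inl ⟨e.1, fun h => v.2 (e.2.2.symm.trans h)⟩, (hsrc _ _).2 e.2.1,
        congrArg Sum.inl (Subtype.ext e.2.2)⟩) ⟨?_, ?_⟩)
    · rintro ⟨a, ha⟩ ⟨a', ha'⟩ h
      cases h
      rfl
    · rintro ⟨a | a, h1, h2⟩
      · exact ⟨⟨a.1, (hsrc _ _).1 h1, congrArg Subtype.val (Sum.inl_injective h2)⟩, rfl⟩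
      · exact absurd h2 Sum.inr_ne_inl
  · refine ENat.card_congr (Equiv.ofBijective
      (fun e => ⟨Sum.inr (⟨e.1, e.2.2⟩, s), (hsrc _ _).2 e.2.1, rfl⟩) ⟨?_, ?_⟩)
    · rintro ⟨a, ha⟩ ⟨a', ha'⟩ h
      cases h
      rfl
    · rintro ⟨a | a, h1, h2⟩
      · exact absurd h2 Sum.inl_ne_inr
      · obtain ⟨a, t⟩ := a
        obtain rfl : t = s := Sum.inr_injective h2
        exact ⟨⟨a.1, (hsrc _ _).1 h1, a.2⟩, rfl⟩
  · refine ENat.card_congr (Equiv.ofBijective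
      (fun e => ⟨Sum.inl ⟨e.1.1, fun h => v.2 (e.2.2.symm.trans h)⟩, (hsrc' _ _).2 ⟨e.1.2, e.2.1⟩,
        congrArg Sum.inl (Subtype.ext e.2.2)⟩) ⟨?_, ?_⟩)
    · rintro ⟨⟨a, _⟩, ha⟩ ⟨⟨a', _⟩, ha'⟩ h
      cases h
      rfl
    · rintro ⟨a | a, h1, h2⟩
      · obtain ⟨h, h'⟩ := (hsrc' _ _).1 h1
        exact ⟨⟨⟨a.1, h⟩, h', congrArg Subtype.val (Sum.inl_injective h2)⟩, rfl⟩
      · exact absurd h2 Sum.inr_ne_inl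
  · refine ENat.card_congr (Equiv.ofBijective
      (fun e => ⟨Sum.inr (⟨e.1.1, e.2.2⟩, s), (hsrc' _ _).2 ⟨e.1.2, e.2.1⟩, rfl⟩) ⟨?_, ?_⟩)
    · rintro ⟨⟨a, _⟩, ha⟩ ⟨⟨a', _⟩, ha'⟩ h
      cases h
      rfl
    · rintro ⟨a | a, h1, h2⟩
      · exact absurd h2 Sum.inl_ne_inr
      · obtain ⟨a, t⟩ := a
        obtain rfl : t = s := Sum.inr_injective h2
        obtain ⟨h, h'⟩ := (hsrc' _ _).1 h1
        exact ⟨⟨⟨a.1, h⟩, h', a.2⟩, rfl⟩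

/-- The edges emitted by `w` can be partitioned into two sets with prescribed numbers of edges to
each vertex. -/
theorem exists_part (a : Fin 2 → E.Vert → ℕ∞) (h : ∀ v, E.edgeCount w v = a 0 v + a 1 v) :
    ∃ part : {e : E.Edge // E.src e = w} → Fin 2, E.partCount w part = a := by
  have key : ∀ v, Nonempty ({e : E.Edge // E.src e = w ∧ E.rng e = v} ≃
      Below (a 0 v) ⊕ Below (a 1 v)) := by
    intro v
    apply nonempty_equiv_of_enatCard_eq
    rw [ENat.card_sum, card_below, card_below]
    exact h v
  let g := fun v => (key v).some
  -- The part of an edge is the summand in which its image under `g` lies.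
  refine ⟨fun e => Sum.elim (fun _ => 0) (fun _ => 1) (g _ ⟨e.1, e.2, rfl⟩), ?_⟩
  funext r v
  rw [partCount, ← card_below (a r v)]
  symm
  fin_cases r
  · refine ENat.card_congr (Equiv.ofBijective (fun k => ⟨⟨((g v).symm (Sum.inl k)).1,
      ((g v).symm (Sum.inl k)).2.1⟩, ?_, ((g v).symm (Sum.inl k)).2.2⟩) ⟨?_, ?_⟩)
    · generalize hy : (g v).symm (Sum.inl k) = y
      rw [Equiv.symm_apply_eq] at hy
      obtain ⟨e, h1, rfl⟩ := y
      simp [← hy]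
    · intro k k' hk
      have : (g v).symm (Sum.inl k) = (g v).symm (Sum.inl k') :=
        Subtype.ext (congrArg (fun z => z.1.1) hk)
      simpa using this
    · rintro ⟨⟨e, h1⟩, h2, rfl⟩
      dsimp only at h2
      have : ∃ k, g (E.rng e) ⟨e, h1, rfl⟩ = Sum.inl k := by
        revert h2
        rcases g (E.rng e) ⟨e, h1, rfl⟩ with k | k <;> intro h2
        · exact ⟨k, rfl⟩
        · simp at h2
      obtain ⟨k, hk⟩ := this
      exact ⟨k, by simp [← hk]⟩
  · refine ENat.card_congr (Equiv.ofBijective (fun k => ⟨⟨((g v).symm (Sum.inr k)).1,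
      ((g v).symm (Sum.inr k)).2.1⟩, ?_, ((g v).symm (Sum.inr k)).2.2⟩) ⟨?_, ?_⟩)
    · generalize hy : (g v).symm (Sum.inr k) = y
      rw [Equiv.symm_apply_eq] at hy
      obtain ⟨e, h1, rfl⟩ := y
      simp [← hy]
    · intro k k' hk
      have : (g v).symm (Sum.inr k) = (g v).symm (Sum.inr k') :=
        Subtype.ext (congrArg (fun z => z.1.1) hk)
      simpa using this
    · rintro ⟨⟨e, h1⟩, h2, rfl⟩
      dsimp only at h2
      have : ∃ k, g (E.rng e) ⟨e, h1, rfl⟩ = Sum.inr k := by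
        revert h2
        rcases g (E.rng e) ⟨e, h1, rfl⟩ with k | k <;> intro h2
        · simp at h2
        · exact ⟨k, rfl⟩
      obtain ⟨k, hk⟩ := this
      exact ⟨k, by simp [← hk]⟩

end OutSplit

/-! ### (R+) and (O) as operations on matrices -/

/-- Adding a new vertex `none` that receives no edges and emits `c v` edges to `v`. -/
def addVertex {W : Type u} (M : W → W → ℕ∞) (c : W → ℕ∞) : Option W → Option W → ℕ∞
  | _, none => 0
  | none, some v => c v
  | some u, some v => M u v

/-- The index `none` of the removed vertex is reused for the new source, so the vertex type stays
the same. -/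
theorem moveRPlus_of_equiv {E : DirGraph.{u}} {W : Type u} [Finite W] (f : Option W ≃ E.Vert)
    (H : Option W → Option W → ℕ∞) (hE : ∀ u v, E.edgeCount (f u) (f v) = H u v)
    (h0 : H none none = 0) (hfin : ∀ v, H none (some v) ≠ ⊤) (hne : ∃ v, H none (some v) ≠ 0) :
    MoveRPlus E (ofMatrix (Option W)
      (addVertex (fun u v => H (some u) (some v) + H (some u) none * H none (some v))
        fun v => H none (some v))) := by
  have hw : ¬ E.SupportsLoop (f none) := by
    rw [supportsLoop_iff, hE, h0]
    simp
  let g : Option W → {v : E.Vert // v ≠ f none} ⊕ PUnit.{u + 1} := fun v =>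
    v.elim (Sum.inr PUnit.unit) fun v => Sum.inl ⟨f (some v), by simp⟩
  have hg : Function.Bijective g := by
    constructor
    · rintro (_ | u) (_ | v) huv <;> simp_all [g]
    · rintro (⟨v, hv⟩ | _)
      · obtain ⟨_ | u, rfl⟩ := f.surjective v
        · exact absurd rfl hv
        · exact ⟨some u, rfl⟩
      · exact ⟨none, rfl⟩
  refine ⟨f none, hw, ?_, iso_ofMatrix (Equiv.ofBijective g hg) ?_⟩
  · refine (isRegular_iff E (f none)).2 ⟨fun v => ?_, ?_⟩
    · obtain ⟨_ | v, rfl⟩ := f.surjective v <;> rw [hE]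
      · simp [h0]
      · exact hfin v
    · obtain ⟨v, hv⟩ := hne
      exact ⟨f (some v), by rwa [hE]⟩
  · rintro (_ | u) (_ | v) <;> symm
    · exact edgeCount_reduction_inr E _ hw _
    · exact (edgeCount_reduction_inr_inl E _ hw _).trans (hE _ _)
    · exact edgeCount_reduction_inr E _ hw _
    · refine (edgeCount_reduction_inl_inl E _ hw _ _).trans ?_
      rw [hE, hE, hE]
      rfl

theorem moveRPlus_ofMatrix {W : Type u} [Finite W] (H : Option W → Option W → ℕ∞)
    (h0 : H none none = 0) (hfin : ∀ v, H none (some v) ≠ ⊤) (hne : ∃ v, H none (some v) ≠ 0) :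
    MoveRPlus (ofMatrix (Option W) H) (ofMatrix (Option W)
      (addVertex (fun u v => H (some u) (some v) + H (some u) none * H none (some v))
        fun v => H none (some v))) :=
  moveRPlus_of_equiv (Equiv.refl (Option W)) H (edgeCount_ofMatrix H) h0 hfin hne

open scoped Classical in
/-- The matrix of an out-split graph at `w`: one of the new vertices is `none` and emits `a v`
edges to `v`, the other one is `some w` and emits `b v` edges to `v`. -/
noncomputable def splitMatrix {W : Type u} (M : W → W → ℕ∞) (w : W) (a b : W → ℕ∞) :
    Option W → Option W → ℕ∞
  | some u, some v => Function.update M w b u v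
  | some u, none => Function.update M w b u w
  | none, some v => a v
  | none, none => a w

open scoped Classical in
-- Finiteness is needed for `a` only: (O) allows one infinite part.
theorem moveO_of_equiv {E : DirGraph.{u}} {W : Type u} [Finite W] (f : W ≃ E.Vert)
    (M : W → W → ℕ∞) (hE : ∀ u v, E.edgeCount (f u) (f v) = M u v) (w : W) (a b : W → ℕ∞)
    (hM : M w = a + b) (ha : ∀ v, a v ≠ ⊤) (ha0 : a ≠ 0) (hb0 : b ≠ 0) :
    MoveO E (ofMatrix (Option W) (splitMatrix M w a b)) := by
  obtain ⟨part, hpart⟩ := exists_part E (f w) ![a ∘ f.symm, b ∘ f.symm] (fun v => by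
    obtain ⟨v, rfl⟩ := f.surjective v
    simp [hE, hM])
  have hpa : ∀ v, E.partCount (f w) part 0 (f v) = a v := by simp [hpart]
  have hpb : ∀ v, E.partCount (f w) part 1 (f v) = b v := by simp [hpart]
  have hne : ∀ r : Fin 2, (∃ v, E.partCount (f w) part r (f v) ≠ 0) → ∃ e, part e = r := by
    rintro r ⟨v, hv⟩
    by_contra! h
    refine hv ?_
    rw [partCount, ENat.card_eq_zero_iff_empty, isEmpty_subtype]
    exact fun e he => h e he.1
  have hne0 : ∃ e, part e = 0 := hne 0 (by simpa [hpa] using Function.ne_iff.1 ha0)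
  have hne1 : ∃ e, part e = 1 := hne 1 (by simpa [hpb] using Function.ne_iff.1 hb0)
  have hfin : {e | part e = 0}.Finite := by
    have : {e | part e = 0} = ⋃ v, {e | part e = 0 ∧ E.rng e.1 = v} := by
      ext e
      simp
    rw [this]
    refine Set.finite_iUnion fun v => ?_
    obtain ⟨v, rfl⟩ := f.surjective v
    have := ha v
    rw [← hpa, partCount, ne_eq, ENat.card_eq_top, not_infinite_iff_finite] at this
    exact this
  let g : Option W → {v : E.Vert // v ≠ f w} ⊕ Fin 2 := fun v =>
    v.elim (Sum.inr 0) fun v => if h : v = w then Sum.inr 1 else Sum.inl ⟨f v, by simpa⟩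
  have hg0 : g none = Sum.inr 0 := rfl
  have hg1 : g (some w) = Sum.inr 1 := dif_pos rfl
  have hg2 : ∀ v (h : v ≠ w), g (some v) = Sum.inl ⟨f v, by simpa⟩ := fun v h => dif_neg h
  have hg : Function.Bijective g := by
    constructor
    · rintro (_ | u) (_ | v) huv
      · rfl
      · by_cases hv : v = w <;> simp [g, hv] at huv
      · by_cases hu : u = w <;> simp [g, hu] at huv
      · by_cases hv : v = w <;> by_cases hu : u = w <;> simp_all [g]
    · rintro (⟨v, hv⟩ | r)
      · obtain ⟨v, rfl⟩ := f.surjective v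
        exact ⟨some v, hg2 v fun h => hv (h ▸ rfl)⟩
      · fin_cases r
        · exact ⟨none, hg0⟩
        · exact ⟨some w, hg1⟩
  obtain ⟨h1, h2, h3, h4⟩ := edgeCount_outSplit E (f w) part
  refine ⟨f w, 2, part, ?_, ?_, ?_, iso_ofMatrix (Equiv.ofBijective g hg) ?_⟩
  · obtain ⟨e, -⟩ := hne0
    exact fun h => h e.1 e.2
  · intro r
    fin_cases r
    · exact hne0
    · exact hne1
  · have key : ∀ r : Fin 2, r ∈ {i : Fin 2 | {e | part e = i}.Infinite} → r = 1 := by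
      intro r hr
      fin_cases r
      · exact absurd hfin hr
      · rfl
    intro r hr s hs
    rw [key r hr, key s hs]
  · suffices h : ∀ u v, splitMatrix M w a b u v = (E.outSplit (f w) part).edgeCount (g u) (g v) from
      h
    rintro (_ | u) (_ | v)
    · exact ((h4 0 0).trans (hpa w)).symm
    · by_cases hv : v = w
      · subst hv
        rw [hg1]
        exact ((h4 0 1).trans (hpa v)).symm
      · rw [hg2 v hv]
        exact ((h3 0 _).trans (hpa v)).symm
    · by_cases hu : u = w
      · subst hu
        rw [hg1, splitMatrix, Function.update_self]
        exact ((h4 1 0).trans (hpb u)).symm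
      · rw [hg2 u hu, splitMatrix, Function.update_of_ne hu]
        exact ((h2 _ 0).trans (hE u w)).symm
    · by_cases hu : u = w <;> by_cases hv : v = w
      · subst hu hv
        rw [hg1, splitMatrix, Function.update_self]
        exact ((h4 1 1).trans (hpb v)).symm
      · subst hu
        rw [hg1, hg2 v hv, splitMatrix, Function.update_self]
        exact ((h3 1 _).trans (hpb v)).symm
      · subst hv
        rw [hg1, hg2 u hu, splitMatrix, Function.update_of_ne hu]
        exact ((h2 _ 1).trans (hE u v)).symm
      · rw [hg2 u hu, hg2 v hv, splitMatrix, Function.update_of_ne hu]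
        exact ((h1 _ _).trans (hE u v)).symm

theorem moveO_ofMatrix {W : Type u} [Finite W] (M : W → W → ℕ∞) (w : W) (a b : W → ℕ∞)
    (hM : M w = a + b) (ha : ∀ v, a v ≠ ⊤) (ha0 : a ≠ 0) (hb0 : b ≠ 0) :
    MoveO (ofMatrix W M) (ofMatrix (Option W) (splitMatrix M w a b)) :=
  moveO_of_equiv (Equiv.refl W) M (edgeCount_ofMatrix M) w a b hM ha ha0 hb0

/-! ### Composite moves: splitting and delaying -/

theorem MoveEquiv.refl (E : DirGraph.{u}) : MoveEquiv E E := Relation.EqvGen.refl E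

theorem MoveEquiv.symm {E F : DirGraph.{u}} (h : MoveEquiv E F) : MoveEquiv F E :=
  Relation.EqvGen.symm _ _ h

theorem MoveEquiv.trans {E F G : DirGraph.{u}} (h : MoveEquiv E F) (h' : MoveEquiv F G) :
    MoveEquiv E G :=
  Relation.EqvGen.trans _ _ _ h h'

theorem Iso.moveEquiv {E F : DirGraph.{u}} (h : Iso E F) : MoveEquiv E F :=
  Relation.EqvGen.rel _ _ (Or.inl h)

theorem MoveO.moveEquiv {E F : DirGraph.{u}} (h : MoveO E F) : MoveEquiv E F :=
  Relation.EqvGen.rel _ _ (Or.inr (Or.inl h))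

theorem MoveRPlus.moveEquiv {E F : DirGraph.{u}} (h : MoveRPlus E F) : MoveEquiv E F :=
  Relation.EqvGen.rel _ _ (Or.inr (Or.inr (Or.inr h)))

open scoped Classical in
/-- Out-splitting at `w` followed by reduction at one of the new vertices. -/
theorem moveEquiv_split_reduce {W : Type u} [Finite W] (M : W → W → ℕ∞) (w : W) (a b : W → ℕ∞)
    (hM : M w = a + b) (ha : ∀ v, a v ≠ ⊤) (ha0 : a ≠ 0) (hb0 : b ≠ 0) (haw : a w = 0) :
    MoveEquiv (ofMatrix W M) (ofMatrix (Option W) (addVertex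
      (fun u v => Function.update M w b u v + Function.update M w b u w * a v) a)) :=
  -- The hypothesis `haw` says that the split-off vertex has no loop, as (R+) requires.
  (moveO_ofMatrix M w a b hM ha ha0 hb0).moveEquiv.trans
    (moveRPlus_ofMatrix (splitMatrix M w a b) haw ha (Function.ne_iff.1 ha0)).moveEquiv

/-- A source with a single edge, to `j`, may be replaced by one that emits the same edges
as `j`. -/
theorem moveEquiv_addVertex_single {W : Type u} [Finite W] [DecidableEq W] (M : W → W → ℕ∞) (j : W)
    (hfin : ∀ v, M j v ≠ ⊤) (hne : M j ≠ 0) :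
    MoveEquiv (ofMatrix (Option W) (addVertex M (Pi.single j 1)))
      (ofMatrix (Option W) (addVertex M (M j))) := by
  -- Divide `j` into a receiving and an emitting vertex joined by one edge. In `H₁` the receiver is
  -- `none`; in `H₂` the emitter is. Exchanging `none` and `some j` identifies the two.
  let H₁ : Option W → Option W → ℕ∞
    | some u, some v => if v = j then 0 else M u v
    | some u, none => M u j
    | none, some v => (Pi.single j 1 : W → ℕ∞) v
    | none, none => 0
  let H₂ : Option W → Option W → ℕ∞
    | some u, some v => if u = j then 0 else M u v
    | some u, none => (Pi.single j 1 : W → ℕ∞) u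
    | none, some v => M j v
    | none, none => 0
  -- Both reductions give `M` back; reducing the receiver leaves a source with one edge to `j`,
  -- reducing the emitter one with row `M j`.
  have h₁ := (moveRPlus_ofMatrix H₁ rfl
    (fun v => by by_cases hv : v = j <;> simp [H₁, hv, Pi.single_apply])
    ⟨j, by simp [H₁]⟩).moveEquiv
  have h₂ := (moveRPlus_ofMatrix H₂ rfl hfin (Function.ne_iff.1 hne)).moveEquiv
  have e₁ : (fun u v => H₁ (some u) (some v) + H₁ (some u) none * H₁ none (some v)) = M := by
    funext u v
    by_cases hv : v = j <;> simp [H₁, hv, Pi.single_apply]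
  have e₂ : (fun u v => H₂ (some u) (some v) + H₂ (some u) none * H₂ none (some v)) = M := by
    funext u v
    by_cases hu : u = j <;> simp [H₂, hu, Pi.single_apply]
  rw [e₁] at h₁
  rw [e₂] at h₂
  refine h₁.symm.trans (Iso.moveEquiv ?_ |>.trans h₂)
  suffices h : ∀ u v : Option W, H₁ u v = H₂ (Equiv.swap none (some j) u)
      (Equiv.swap none (some j) v) from
    iso_ofMatrix (Equiv.swap (none : Option W) (some j)) fun u v =>
      (h u v).trans (edgeCount_ofMatrix _ _ _).symm
  have s₀ : Equiv.swap none (some j) none = some j := Equiv.swap_apply_left _ _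
  have s₁ : Equiv.swap none (some j) (some j) = none := Equiv.swap_apply_right _ _
  have s₂ : ∀ u, u ≠ j → Equiv.swap none (some j) (some u) = some u := fun u hu =>
    Equiv.swap_apply_of_ne_of_ne (by simp) (by simpa)
  rintro (_ | u) (_ | v)
  · rw [s₀]
    simp [H₁, H₂]
  · by_cases hv : v = j
    · rw [hv, s₀, s₁]
    · rw [s₀, s₂ v hv]
      simp [H₁, H₂, hv]
  · by_cases hu : u = j
    · rw [hu, s₀, s₁]
    · rw [s₀, s₂ u hu]
      simp [H₁, H₂, hu]
  · by_cases hu : u = j <;> by_cases hv : v = j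
    · rw [hu, hv, s₁]
      simp [H₁, H₂]
    · rw [hu, s₁, s₂ v hv]
      simp [H₁, H₂, hv]
    · rw [hv, s₁, s₂ u hu]
      simp [H₁, H₂, hu]
    · rw [s₂ u hu, s₂ v hv]
      simp [H₁, H₂, hu, hv]

/-! ### Graphs with at most one added source -/

/-- Extension of a vector by zero. -/
def extendZero {V : Type u} (c : V → ℕ∞) : Option V → ℕ∞ := fun v => v.elim 0 c

theorem extendZero_ne_zero {V : Type u} {c : V → ℕ∞} (hc : c ≠ 0) : extendZero c ≠ 0 := fun h =>
  hc (funext fun v => congrFun h (some v))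

theorem extendZero_ne_top {V : Type u} {c : V → ℕ∞} (hc : ∀ v, c v ≠ ⊤) : ∀ v, extendZero c v ≠ ⊤ := by
  rintro (_ | v)
  · simp [extendZero]
  · exact hc v

section Source

variable {V : Type u} [Finite V]

open scoped Classical in
/-- The graph with `A u v` edges from `u` to `v` and, unless `c = 0`, an additional source
that emits `c v` edges to `v`. -/
noncomputable def withSource (A : V → V → ℕ∞) (c : V → ℕ∞) : DirGraph.{u} :=
  -- A source emitting nothing would be a singular vertex, hence the case `c = 0`.
  if c = 0 then ofMatrix V A else ofMatrix (Option V) (addVertex A c)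

theorem withSource_zero (A : V → V → ℕ∞) : withSource A 0 = ofMatrix V A := if_pos rfl

theorem withSource_of_ne_zero (A : V → V → ℕ∞) {c : V → ℕ∞} (hc : c ≠ 0) :
    withSource A c = ofMatrix (Option V) (addVertex A c) := if_neg hc

/-- Two sources may be merged. -/
theorem moveEquiv_merge (A : V → V → ℕ∞) (c c' : V → ℕ∞) (hc : c ≠ 0) (hc' : c' ≠ 0)
    (hfin : ∀ v, c' v ≠ ⊤) :
    MoveEquiv (withSource A (c + c'))
      (ofMatrix (Option (Option V)) (addVertex (addVertex A c) (extendZero c'))) := by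
  have h0 : c + c' ≠ 0 := fun h => hc (funext fun v => (add_eq_zero.1 (congrFun h v)).1)
  rw [withSource_of_ne_zero A h0]
  -- The source is split in two. Since it receives nothing, reducing one half only recreates that
  -- half.
  convert moveEquiv_split_reduce (addVertex A (c + c')) none (extendZero c') (extendZero c) ?_
    (extendZero_ne_top hfin) (extendZero_ne_zero hc') (extendZero_ne_zero hc) rfl using 3
  · funext u v
    rcases u with _ | u <;> rcases v with _ | v <;> simp [addVertex, extendZero]
  · funext v
    rcases v with _ | v
    · simp [addVertex, extendZero]
    · simp [addVertex, extendZero, add_comm]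

open scoped Classical in
-- Every edge into `w` is doubled by the splitting, and the copy into the split-off half is
-- prolonged along `a`. For edges from the source this gives `c w * a v`; the last `a` is the row of
-- the source created by (R+).
theorem moveEquiv_withSource_split_reduce (A : V → V → ℕ∞) (c : V → ℕ∞) (w : V) (a b : V → ℕ∞)
    (hA : A w = a + b) (ha : ∀ v, a v ≠ ⊤) (ha0 : a ≠ 0) (hb0 : b ≠ 0) (haw : a w = 0) :
    MoveEquiv (withSource A c)
      (withSource (fun u v => Function.update A w b u v + Function.update A w b u w * a v)
        ((fun v => c v + c w * a v) + a)) := by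
  by_cases hc : c = 0
  · subst hc
    have : ((fun v => (0 : V → ℕ∞) v + (0 : V → ℕ∞) w * a v) + a) = a := by
      funext v
      simp
    rw [this, withSource_zero, withSource_of_ne_zero _ ha0]
    exact moveEquiv_split_reduce A w a b hA ha ha0 hb0 haw
  · have hc' : (fun v => c v + c w * a v) ≠ 0 := fun h =>
      hc (funext fun v => (add_eq_zero.1 (congrFun h v)).1)
    refine MoveEquiv.trans ?_ (moveEquiv_merge _ _ _ hc' ha0 ha).symm
    rw [withSource_of_ne_zero A hc]
    convert moveEquiv_split_reduce (addVertex A c) (some w) (extendZero a) (extendZero b) ?_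
      (extendZero_ne_top ha) (extendZero_ne_zero ha0) (extendZero_ne_zero hb0) haw using 3
    · funext u v
      rcases u with _ | u <;> rcases v with _ | v
      · simp [addVertex, extendZero]
      · simp [addVertex, extendZero]
      · by_cases hu : u = w <;> simp [addVertex, extendZero, hu]
      · by_cases hu : u = w <;> simp [addVertex, extendZero, hu]
    · funext v
      rcases v with _ | v
      · simp [addVertex, extendZero]
      · simp [addVertex, extendZero, hA]

open scoped Classical in
-- Delaying is performed in the graph that already contains the source `c` as an ordinary vertex;
-- this does not affect the row of `j`.
theorem moveEquiv_withSource_single (A : V → V → ℕ∞) (c : V → ℕ∞) (j : V)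
    (hfin : ∀ v, A j v ≠ ⊤) (hne : A j ≠ 0) :
    MoveEquiv (withSource A (c + Pi.single j 1)) (withSource A (c + A j)) := by
  have hs : (Pi.single j 1 : V → ℕ∞) ≠ 0 := by simp
  by_cases hc : c = 0
  · rw [hc, zero_add, zero_add, withSource_of_ne_zero A hs, withSource_of_ne_zero A hne]
    exact moveEquiv_addVertex_single A j hfin hne
  · refine (moveEquiv_merge A c _ hc hs ?_).trans (MoveEquiv.trans ?_
      (moveEquiv_merge A c _ hc hne hfin).symm)
    · intro v
      by_cases hv : v = j <;> simp [hv]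
    · have h1 : extendZero (Pi.single j 1) = Pi.single (some j) 1 := by
        funext v
        rcases v with _ | v
        · simp [extendZero]
        · by_cases hv : v = j <;> simp [extendZero, hv]
      have h2 : extendZero (A j) = addVertex A c (some j) := by
        funext v
        rcases v with _ | v <;> rfl
      rw [h1, h2]
      refine moveEquiv_addVertex_single (addVertex A c) (some j) ?_ ?_ <;> rw [← h2]
      · exact extendZero_ne_top hfin
      · exact extendZero_ne_zero hne

open scoped Classical in
/-- The source may emit `b v` more edges to `v`, where `b v` is the number of edges from `j` to `v`,
minus one if `v = j`. -/
theorem moveEquiv_withSource_add (A : V → V → ℕ∞) (c b : V → ℕ∞) (j : V)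
    (hb : A j = b + Pi.single j 1) (hfin : ∀ v, A j v ≠ ⊤)
    (hloop : ∀ k, (∀ v, A k v ≠ ⊤) → (∃ v, A k v ≠ 0) → A k k ≠ 0)
    (hex : b j ≠ 0 → c j ≠ 0 ∨ ∃ k, k ≠ j ∧ A k j ≠ 0) :
    MoveEquiv (withSource A c) (withSource A (c + b)) := by
  have hs : (Pi.single j 1 : V → ℕ∞) ≠ 0 := by simp
  have hsfin : ∀ v, (Pi.single j 1 : V → ℕ∞) v ≠ ⊤ := by
    intro v
    by_cases hv : v = j <;> simp [hv]
  have split : ∀ d : V → ℕ∞, d j ≠ 0 → ∃ d', d = d' + (Pi.single j 1 : V → ℕ∞) := by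
    refine fun d hd => ⟨d - Pi.single j 1, (tsub_add_cancel_of_le fun v => ?_).symm⟩
    by_cases hv : v = j
    · simpa [hv, Order.one_le_iff_ne_zero] using hd
    · simp [hv]
  have hAj : A j ≠ 0 := by
    rw [hb]
    intro h
    exact hs (funext fun v => (add_eq_zero.1 (congrFun h v)).2)
  by_cases hcj : c j ≠ 0
  · obtain ⟨d, rfl⟩ := split c hcj
    rw [add_assoc, add_comm (Pi.single j 1), ← hb]
    exact moveEquiv_withSource_single A d j hfin hAj
  by_cases hk : ∃ k, k ≠ j ∧ A k j ≠ 0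
  · obtain ⟨k, hkj, hk⟩ := hk
    obtain ⟨a, ha⟩ := split (A k) hk
    -- Otherwise `k` is regular with no edge but the one to `j`, so it lacks the loop that `hloop`
    -- demands.
    have ha0 : a ≠ 0 := by
      intro h
      rw [h, zero_add] at ha
      refine hloop k (fun v => ha ▸ hsfin v) ⟨j, hk⟩ ?_
      rw [ha]
      simp [hkj]
    rw [add_comm] at ha
    -- Splitting the edge to `j` off from `k` changes `A` in the same way for every source row, so
    -- it applies to both `c` and `c + b`.
    have hmove := fun d : V → ℕ∞ => moveEquiv_withSource_split_reduce A d k (Pi.single j 1) a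
      ha hsfin hs ha0 (by simp [hkj])
    refine (hmove c).trans (MoveEquiv.trans ?_ (hmove (c + b)).symm)
    set A' : V → V → ℕ∞ := fun u v => Function.update A k a u v +
      Function.update A k a u k * (Pi.single j 1 : V → ℕ∞) v
    have hA' : A' j = fun v => A j v + A j k * (Pi.single j 1 : V → ℕ∞) v := by
      funext v
      simp [A', hkj.symm]
    have h' := moveEquiv_withSource_single A' (fun v => c v + c k * (Pi.single j 1 : V → ℕ∞) v) j
      ?_ ?_
    -- As `A' j = b + e_j + b k • e_j`, delaying adds `b + b k • e_j`, which is how the rows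
    -- obtained from `c` and `c + b` differ.
    · convert h' using 2
      have hjk : A j k = b k := by
        rw [hb]
        simp [hkj]
      rw [hA', hjk, hb]
      funext v
      simp only [Pi.add_apply]
      ring
    · intro v
      rw [hA']
      exact WithTop.add_ne_top.2 ⟨hfin v, WithTop.mul_ne_top (hfin k) (hsfin v)⟩
    · rw [hA']
      intro h
      exact hAj (funext fun v => (add_eq_zero.1 (congrFun h v)).1)
  -- Now `j` receives only its own loops, so by `hex` it has exactly one.
  have hbj : b j = 0 := by
    by_contra h
    exact (hex h).elim hcj hk
  by_cases hb0 : b = 0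
  · rw [hb0, add_zero]
    exact MoveEquiv.refl _
  push Not at hcj hk
  -- The half of `j` that keeps the loop regains `b` through the reduced half, and no other row
  -- changes since nothing else enters `j`.
  convert moveEquiv_withSource_split_reduce A c j b (Pi.single j 1) hb
    (fun v h => hfin v (by rw [hb, Pi.add_apply, h, top_add])) hb0 hs hbj using 2
  · funext u v
    by_cases hu : u = j
    · subst hu
      simp [hb, add_comm]
    · simp [hu, hk]
  · funext v
    simp [hcj]

end Source

/-! ### From representing pairs to matrices with a source -/

/-- The numbers of edges between the vertices enumerated by `x`. -/
noncomputable def countMatrix (E : DirGraph.{u}) {n : ℕ} (x : Fin n → E.Vert) :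
    ULift.{u} (Fin n) → ULift.{u} (Fin n) → ℕ∞ :=
  fun u v => E.edgeCount (x u.down) (x v.down)

/-- The numbers of edges from regular sources to the vertices enumerated by `x`. -/
noncomputable def sourceCount (E : DirGraph.{u}) {n : ℕ} (x : Fin n → E.Vert) :
    ULift.{u} (Fin n) → ℕ∞ :=
  fun i => ENat.card {e : E.Edge // E.IsRegularSource (E.src e) ∧ E.rng e = x i.down}

section Representation

variable {E : DirGraph.{u}} {n : ℕ} {x : Fin n → E.Vert}

theorem sourceCount_eq_zero (h : ∀ v, ¬ E.IsRegularSource v) : E.sourceCount x = 0 := by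
  funext i
  rw [sourceCount, Pi.zero_apply, ENat.card_eq_zero_iff_empty, isEmpty_subtype]
  exact fun e he => h _ he.1

theorem sourceCount_eq_edgeCount {s : E.Vert} (h : ∀ v, E.IsRegularSource v ↔ v = s)
    (i : ULift.{u} (Fin n)) : E.sourceCount x i = E.edgeCount s (x i.down) := by
  simp only [sourceCount, edgeCount, h]

theorem RepresentedBy.eq_of_isRegularSource {D : Fin n → WithTop ℤ}
    {B : Matrix (Fin n) (Fin n) (WithTop ℤ)} (h : E.RepresentedBy x D B) {s : E.Vert}
    (hs : E.IsRegularSource s) (v : E.Vert) : E.IsRegularSource v ↔ v = s :=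
  ⟨fun hv => h.subsingleton_regularSource hv hs, fun hv => hv ▸ hs⟩

theorem RepresentedBy.sourceCount_ne_top {D : Fin n → WithTop ℤ}
    {B : Matrix (Fin n) (Fin n) (WithTop ℤ)} (h : E.RepresentedBy x D B) (i : ULift.{u} (Fin n)) :
    E.sourceCount x i ≠ ⊤ := by
  by_cases hs : ∃ s, E.IsRegularSource s
  · obtain ⟨s, hs⟩ := hs
    rw [sourceCount_eq_edgeCount (h.eq_of_isRegularSource hs)]
    exact ((isRegular_iff E s).1 hs.1).1 _
  · rw [sourceCount_eq_zero (not_exists.1 hs)]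
    simp

theorem RepresentedBy.iso_withSource {D : Fin n → WithTop ℤ}
    {B : Matrix (Fin n) (Fin n) (WithTop ℤ)} (h : E.RepresentedBy x D B) :
    Iso (withSource (E.countMatrix x) (E.sourceCount x)) E := by
  by_cases hs : ∃ s, E.IsRegularSource s
  · obtain ⟨s, hs⟩ := hs
    have hxs : ∀ i, x i ≠ s := fun i hi => (h.mem_range_iff _).1 ⟨i, rfl⟩ (hi ▸ hs)
    have hsource := (isSource_iff E s).1 hs.2
    let f : Option (ULift.{u} (Fin n)) → E.Vert := fun v => v.elim s fun i => x i.down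
    have hf : Function.Bijective f := by
      constructor
      · rintro (_ | i) (_ | k) hik
        · rfl
        · exact absurd hik.symm (hxs _)
        · exact absurd hik (hxs _)
        · exact congrArg some (ULift.ext _ _ (h.injective hik))
      · intro v
        by_cases hv : E.IsRegularSource v
        · exact ⟨none, ((h.eq_of_isRegularSource hs v).1 hv).symm⟩
        · obtain ⟨i, rfl⟩ := (h.mem_range_iff v).2 hv
          exact ⟨some ⟨i⟩, rfl⟩
    have hc := sourceCount_eq_edgeCount (x := x) (h.eq_of_isRegularSource hs)
    -- The source is regular and receives nothing, so it emits an edge to an enumerated vertex.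
    have hc0 : E.sourceCount x ≠ 0 := by
      intro h0
      obtain ⟨w, hw⟩ := ((isRegular_iff E s).1 hs.1).2
      obtain ⟨_ | i, rfl⟩ := hf.2 w
      · exact hw (hsource s)
      · exact hw ((hc i).symm.trans (congrFun h0 i))
    rw [withSource_of_ne_zero _ hc0]
    refine iso_ofMatrix (Equiv.ofBijective f hf) ?_
    rintro (_ | u) (_ | v)
    · exact (hsource _).symm
    · exact hc v
    · exact (hsource _).symm
    · rfl
  · rw [sourceCount_eq_zero (not_exists.1 hs), withSource_zero]
    refine iso_ofMatrix (Equiv.ofBijective (fun i => x i.down) ⟨?_, ?_⟩) fun _ _ => rfl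
    · exact fun i k hik => ULift.ext _ _ (h.injective hik)
    · intro v
      obtain ⟨i, rfl⟩ := (h.mem_range_iff v).2 (not_exists.1 hs v)
      exact ⟨⟨i⟩, rfl⟩

theorem representedBy_of_surjective (hx : Function.Bijective x)
    (hloop : ∀ v, E.IsRegular v → E.SupportsLoop v) :
    E.RepresentedBy x (fun i => WithTop.map (fun c : ℕ => (c : ℤ) + 1) (E.sourceCount x ⟨i⟩))
      (fun i k => WithTop.map (fun a : ℕ => (a : ℤ) - if i = k then 1 else 0)
        (E.edgeCount (x k) (x i))) where
  injective := hx.1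
  mem_range_iff v := by
    refine iff_of_true (hx.2 v) fun hv => ?_
    obtain ⟨e, -, he⟩ := hloop v hv.1
    exact hv.2 e he
  subsingleton_regularSource := by
    intro v hv
    obtain ⟨e, -, he⟩ := hloop v hv.1
    exact absurd he (hv.2 e)
  B_eq _ _ := rfl
  D_eq _ := rfl

theorem representedBy_of_isRegularSource (hx : Function.Injective x) {s : E.Vert}
    (hs : E.IsRegularSource s) (hxs : ∀ v, v ∈ Set.range x ↔ v ≠ s)
    (hloop : ∀ v, v ≠ s → E.IsRegular v → E.SupportsLoop v) :
    E.RepresentedBy x (fun i => WithTop.map (fun c : ℕ => (c : ℤ) + 1) (E.sourceCount x ⟨i⟩))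
      (fun i k => WithTop.map (fun a : ℕ => (a : ℤ) - if i = k then 1 else 0)
        (E.edgeCount (x k) (x i))) := by
  have key : ∀ v, E.IsRegularSource v ↔ v = s := by
    refine fun v => ⟨fun hv => ?_, fun hv => hv ▸ hs⟩
    by_contra hvs
    obtain ⟨e, -, he⟩ := hloop v hvs hv.1
    exact hv.2 e he
  exact
  { injective := hx
    mem_range_iff := fun v => by rw [hxs, key]
    subsingleton_regularSource := fun v hv w hw => ((key v).1 hv).trans ((key w).1 hw).symm
    B_eq := fun _ _ => rfl
    D_eq := fun _ => rfl }

theorem RepresentedBy.congr {D D' : Fin n → WithTop ℤ} {B B' : Matrix (Fin n) (Fin n) (WithTop ℤ)}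
    (h : E.RepresentedBy x D B) (hD : ∀ i, D' i = D i) (hB : ∀ i k, B' i k = B i k) :
    E.RepresentedBy x D' B' := by
  rwa [show D' = D from funext hD, show B' = B from Matrix.ext hB]

/-- Finiteness of `c` makes the added source regular when `c ≠ 0`; `hloop` prevents any other vertex
from being a regular source. -/
theorem exists_representedBy (A : ULift.{u} (Fin n) → ULift.{u} (Fin n) → ℕ∞)
    (c : ULift.{u} (Fin n) → ℕ∞) (hc : ∀ i, c i ≠ ⊤)
    (hloop : ∀ k, (∀ v, A k v ≠ ⊤) → (∃ v, A k v ≠ 0) → A k k ≠ 0) :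
    ∃ (F : DirGraph.{u}) (y : Fin n → F.Vert), F.RepresentedBy y
      (fun i => WithTop.map (fun c : ℕ => (c : ℤ) + 1) (c ⟨i⟩))
      (fun i k => WithTop.map (fun a : ℕ => (a : ℤ) - if i = k then 1 else 0) (A ⟨k⟩ ⟨i⟩)) := by
  by_cases hc0 : c = 0
  · let F := ofMatrix (ULift.{u} (Fin n)) A
    have hF : ∀ u v : ULift.{u} (Fin n), F.edgeCount u v = A u v := edgeCount_ofMatrix A
    have hl : ∀ v, F.IsRegular v → F.SupportsLoop v := by
      intro v hv
      rw [isRegular_iff] at hv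
      rw [supportsLoop_iff]
      obtain ⟨h1, w, h2⟩ := hv
      exact (hF v v).trans_ne
        (hloop v (fun w => (hF v w).symm.trans_ne (h1 w)) ⟨w, (hF v w).symm.trans_ne h2⟩)
    have hrep := representedBy_of_surjective (E := F) (x := fun i => (ULift.up i : ULift.{u} (Fin n)))
      ⟨fun i k h => congrArg ULift.down h, fun v => ⟨v.down, rfl⟩⟩ hl
    have h0 := sourceCount_eq_zero (E := F) (x := fun i => (ULift.up i : ULift.{u} (Fin n)))
      fun v hv => by
        obtain ⟨e, -, he⟩ := hl v hv.1
        exact hv.2 e he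
    exact ⟨F, fun i => (ULift.up i : ULift.{u} (Fin n)), hrep.congr
      (fun i => congrArg _ ((congrFun hc0 _).trans (congrFun h0 _).symm))
      fun i k => congrArg _ (hF _ _).symm⟩
  · let F := ofMatrix (Option (ULift.{u} (Fin n))) (addVertex A c)
    have hF : ∀ u v : Option (ULift.{u} (Fin n)), F.edgeCount u v = addVertex A c u v :=
      edgeCount_ofMatrix (addVertex A c)
    let s : F.Vert := (none : Option (ULift.{u} (Fin n)))
    let y : Fin n → F.Vert := fun i => (some (ULift.up i) : Option (ULift.{u} (Fin n)))
    have cases_vert : ∀ v : F.Vert, v = s ∨ ∃ i, v = y i := by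
      rintro (_ | i)
      · exact Or.inl rfl
      · exact Or.inr ⟨i.down, rfl⟩
    have hys : ∀ i, y i ≠ s := fun i => Option.some_ne_none _
    have h0 : ∀ v, F.edgeCount v s = 0 := by
      intro v
      obtain rfl | ⟨i, rfl⟩ := cases_vert v
      · exact hF none none
      · exact hF (some ⟨i⟩) none
    have hFs : ∀ i, F.edgeCount s (y i) = c ⟨i⟩ := fun i => hF none (some ⟨i⟩)
    have hFy : ∀ i k, F.edgeCount (y i) (y k) = A ⟨i⟩ ⟨k⟩ := fun i k => hF (some ⟨i⟩) (some ⟨k⟩)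
    have hs : F.IsRegularSource s := by
      refine ⟨(isRegular_iff F s).2 ⟨fun v => ?_, ?_⟩, (isSource_iff F s).2 h0⟩
      · obtain rfl | ⟨i, rfl⟩ := cases_vert v
        · simp [h0]
        · rw [hFs]
          exact hc _
      · obtain ⟨i, hi⟩ := Function.ne_iff.1 hc0
        exact ⟨y i.down, by rwa [hFs]⟩
    have hl : ∀ v, v ≠ s → F.IsRegular v → F.SupportsLoop v := by
      intro v hvs hv
      obtain rfl | ⟨i, rfl⟩ := cases_vert v
      · exact absurd rfl hvs
      rw [isRegular_iff] at hv
      rw [supportsLoop_iff, hFy]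
      obtain ⟨h1, w, h2⟩ := hv
      refine hloop _ (fun k => ?_) ?_
      · have := h1 (y k.down)
        rwa [hFy] at this
      · obtain rfl | ⟨k, rfl⟩ := cases_vert w
        · exact absurd (h0 _) h2
        · rw [hFy] at h2
          exact ⟨_, h2⟩
    have hrep := representedBy_of_isRegularSource (E := F) (x := y)
      (fun i k h => congrArg ULift.down (Option.some_injective _ h)) hs (fun v => by
        obtain rfl | ⟨i, rfl⟩ := cases_vert v
        · simp [hys]
        · simp [hys i]) hl
    exact ⟨F, y, hrep.congr (fun i => congrArg _ ((sourceCount_eq_edgeCount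
      (hrep.eq_of_isRegularSource hs) _).trans (hFs i)).symm) fun i k => congrArg _ (hFy _ _).symm⟩

/-- The edge by which the path first reaches `w` starts elsewhere. -/
theorem exists_edge_of_isPath {v w : E.Vert} (hvw : v ≠ w) {p : List E.Edge}
    (hp : E.IsPath v p w) : ∃ e, E.src e ≠ w ∧ E.rng e = w := by
  induction p generalizing v with
  | nil => exact absurd hp hvw
  | cons e p ih =>
    obtain ⟨h1, h2⟩ := hp
    by_cases he : E.rng e = w
    · exact ⟨e, h1 ▸ hvw, he⟩
    · exact ih he h2

theorem isReturnPath_singleton {e : E.Edge} {v : E.Vert} (h1 : E.src e = v) (h2 : E.rng e = v) :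
    E.IsReturnPath v [e] :=
  ⟨by simp, ⟨h1, h2⟩, by simp⟩

/-- In a graph in augmented canonical form, a vertex with two loops receives an edge from another
vertex. -/
theorem AugmentedCanonicalForm.exists_edge (h : E.AugmentedCanonicalForm) {v : E.Vert}
    (hv : ¬ E.IsRegularSource v) (h2 : 2 ≤ E.edgeCount v v) :
    ∃ e, E.src e ≠ v ∧ E.rng e = v := by
  have : 1 < ENat.card {e : E.Edge // E.src e = v ∧ E.rng e = v} :=
    lt_of_lt_of_le (by norm_num) h2
  rw [ENat.one_lt_card_iff_nontrivial] at this
  obtain ⟨⟨e, he⟩, ⟨f, hf⟩, hef⟩ := this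
  -- Two loops are two return paths, so (IV) gives at least three regular vertices in the component,
  -- one of them different from `v`.
  have hcard := (h.two_paths v hv ⟨[e], [f], by simpa using hef,
    isReturnPath_singleton he.1 he.2, isReturnPath_singleton hf.1 hf.2⟩).2
  obtain ⟨w, hw, hwv⟩ := Set.exists_ne_of_one_lt_ncard
    (show 1 < (E.regularComponent v).ncard from lt_of_lt_of_le (by norm_num)
      ((le_max_left _ _).trans hcard)) v
  obtain hw | hw := hw.1
  · exact absurd hw hwv
  · obtain ⟨p, -, hp⟩ := hw.2
    exact exists_edge_of_isPath hwv hp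

end Representation

end DirGraph

/-! ### The theorem -/

theorem mainTheorem3 (E : DirGraph.{u}) {n : ℕ} (x : Fin n → E.Vert)
    (D : Fin n → WithTop ℤ) (B : Matrix (Fin n) (Fin n) (WithTop ℤ))
    (hrep : E.RepresentedBy x D B) (hcan : E.AugmentedCanonicalForm)
    (j : Fin n) (hj : E.IsRegular (x j)) :
    (∃ (F : DirGraph.{u}) (y : Fin n → F.Vert),
      F.RepresentedBy y (fun i => D i + B i j) B) ∧
    ∀ (F : DirGraph.{u}) (y : Fin n → F.Vert),
      F.RepresentedBy y (fun i => D i + B i j) B → DirGraph.MoveEquiv E F := by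
  classical
  open DirGraph in
  set A := E.countMatrix x
  set c := E.sourceCount x with hc
  set J : ULift.{u} (Fin n) := ⟨j⟩ with hJ
  have hnot : ∀ i, ¬ E.IsRegularSource (x i) := fun i => (hrep.mem_range_iff _).1 ⟨i, rfl⟩
  have hcfin : ∀ i, c i ≠ ⊤ := hrep.sourceCount_ne_top
  have hloop : ∀ k, (∀ v, A k v ≠ ⊤) → (∃ v, A k v ≠ 0) → A k k ≠ 0 := by
    rintro k h1 ⟨v, h2⟩
    refine (supportsLoop_iff E _).1 (hcan.loops _ ?_ ?_)
    all_goals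
      have hreg : E.IsRegular (x k.down) := by
        refine (isRegular_iff E _).2 ⟨fun w => ?_, x v.down, h2⟩
        -- `A` has no column for a regular source, but such a vertex receives no edges.
        by_cases hw : E.IsRegularSource w
        · rw [(isSource_iff E w).1 hw.2]
          simp
        · obtain ⟨i, rfl⟩ := (hrep.mem_range_iff w).2 hw
          exact h1 ⟨i⟩
    · exact hreg
    · exact fun hs => hnot k.down ⟨hreg, hs⟩
  have hAfin : ∀ v, A J v ≠ ⊤ := fun v => ((isRegular_iff E _).1 hj).1 _
  have hAJ : A J J ≠ 0 :=
    (supportsLoop_iff E _).1 (hcan.loops _ hj fun hs => hnot j ⟨hj, hs⟩)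
  -- This is column `j` of `B`, nonnegative thanks to the loop at `x j`.
  obtain ⟨b, hb⟩ : ∃ b : ULift.{u} (Fin n) → ℕ∞, A J = b + Pi.single J 1 := by
    refine ⟨A J - Pi.single J 1, (tsub_add_cancel_of_le fun v => ?_).symm⟩
    by_cases hv : v = J
    · simpa [hv, Order.one_le_iff_ne_zero] using hAJ
    · simp [hv]
  have hbfin : ∀ v, b v ≠ ⊤ := fun v h => hAfin v (by rw [hb, Pi.add_apply, h, top_add])
  have hD : ∀ i, D i + B i j = WithTop.map (fun c : ℕ => (c : ℤ) + 1) ((c + b) ⟨i⟩) := by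
    intro i
    obtain ⟨p, hp⟩ := ENat.ne_top_iff_exists.1 (hcfin ⟨i⟩)
    obtain ⟨q, hq⟩ := ENat.ne_top_iff_exists.1 (hbfin ⟨i⟩)
    have hAi : E.edgeCount (x j) (x i) = ((q + if i = j then 1 else 0 : ℕ) : ℕ∞) := by
      have := congrFun hb ⟨i⟩
      rw [Pi.add_apply, ← hq] at this
      refine this.trans ?_
      by_cases hij : i = j
      · subst hij
        simp [hJ]
      · have : (⟨i⟩ : ULift.{u} (Fin n)) ≠ J := fun h => hij (congrArg ULift.down h)
        simp [hij, this]
    have hci : D i = WithTop.map (fun c : ℕ => (c : ℤ) + 1) ((p : ℕ) : ℕ∞) :=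
      (hrep.D_eq i).trans (by rw [hp]; rfl)
    rw [hci, hrep.B_eq, hAi, Pi.add_apply, ← hp, ← hq, ← Nat.cast_add]
    change (((p : ℤ) + 1 : ℤ) : WithTop ℤ) + (((q + if i = j then 1 else 0 : ℕ) : ℤ) -
      (if i = j then 1 else 0) : ℤ) = (((p + q : ℕ) : ℤ) + 1 : ℤ)
    rw [← WithTop.coe_add]
    congr 1
    split_ifs <;> push_cast <;> ring
  have hmap1 : Function.Injective fun c : ℕ => (c : ℤ) + 1 := fun a b h => by simpa using h
  have hmap2 : ∀ i k : Fin n,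
      Function.Injective fun a : ℕ => (a : ℤ) - if i = k then 1 else 0 :=
    fun i k a b h => by simpa using h
  refine ⟨?_, fun F y hF => ?_⟩
  · obtain ⟨F, y, hF⟩ := exists_representedBy A (c + b)
      (fun i => WithTop.add_ne_top.2 ⟨hcfin i, hbfin i⟩) hloop
    exact ⟨F, y, hF.congr hD hrep.B_eq⟩
  -- The shifts relating counts to `D` and `B` are injective, so the pair determines the matrix and
  -- the source row of `F`.
  · have hAF : F.countMatrix y = A := by
      funext k i
      exact WithTop.map_injective (hmap2 i.down k.down)
        ((hF.B_eq i.down k.down).symm.trans (hrep.B_eq i.down k.down))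
    have hcF : F.sourceCount y = c + b := by
      funext i
      exact WithTop.map_injective hmap1 ((hF.D_eq i.down).symm.trans (hD i.down))
    have hFiso := hF.iso_withSource
    rw [hAF, hcF] at hFiso
    refine hrep.iso_withSource.moveEquiv.symm.trans (MoveEquiv.trans ?_ hFiso.moveEquiv)
    refine moveEquiv_withSource_add A c b J (by convert hb) hAfin hloop fun hbJ => ?_
    have h2 : 2 ≤ E.edgeCount (x j) (x j) := by
      have : E.edgeCount (x j) (x j) = b J + 1 :=
        (congrFun hb J).trans (by simp)
      rw [this]
      have := add_le_add_left (Order.one_le_iff_ne_zero.2 hbJ) 1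
      rwa [one_add_one_eq_two] at this
    obtain ⟨e, he1, he2⟩ := hcan.exists_edge (hnot j) h2
    -- The edge entering `x j` from outside is counted in `c` or in another row of `A`.
    by_cases hs : E.IsRegularSource (E.src e)
    · left
      intro h0
      rw [hc, sourceCount, ENat.card_eq_zero_iff_empty, isEmpty_subtype] at h0
      exact h0 e ⟨hs, he2⟩
    · right
      obtain ⟨k, hk⟩ := (hrep.mem_range_iff _).2 hs
      refine ⟨⟨k⟩, fun h => he1 ?_, fun h0 => ?_⟩
      · rw [← hk, show k = j from congrArg ULift.down h]
      · exact (edgeCount_eq_zero_iff E _ _).1 h0 e hk.symm he2
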